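/- Let $E$ be a finite set of $n$ agents and let $(E,f)$ be a polymatroid, i.e. $f:2^E\to\mathbb R_{\ge 0}$ satisfies $f(\emptyset)=0$, is monotone, and $f(A)+f(B)\ge f(A\cup B)+f(A\cap B)$ for all $A,B\subseteq E$. Let $\mathcal P(f)=\{x\in\mathbb R_{\ge 0}^E : \sum_{i\in A}x_i\le f(A)\ \forall A\subseteq E\}$ and $\mathcal B(f)=\{x\in\mathcal P(f):\sum_{i\in E}x_i=f(E)\}$. The values $v_i$ of the agents are drawn independently from distributions $D_i$ supported on a common finite set of positive reals. A full-revelation signaling policy $\Omega$ sends the realized value of each agent to the receiver; it is specified by a probability distribution over selection rules, where a selection rule assigns to each vector $v$ of revealed values an allocation $x(v)\in\mathcal P(f)$, which for every $v$ of positive probability maximizes the welfare $\sum_{i\in E} v_i x_i$ over $\mathcal P(f)$. The expected utility of agent $i$ is $U_i(\Omega)=\mathbb E[v_i\,x_i(v)]$, the expectation being over $v$ and over the random choice of the selection rule. Let $\mathcal U=\{(U_i(\Omega))_{i\in E}\}$ be the set of expected utility vectors of all full-revelation signaling policies. For $S\subseteq E$ and a vector $v$ of possible values let $$g(S;v)=\max\Big\{\sum_{i\in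 S}v_ix_i : x\in\mathcal P(f)\text{ maximizes }\sum_{i\in E}v_ix_i\text{ over }\mathcal P(f)\Big\}.$$ Then $\mathcal U$ has a $1$-majorized point: there is $u\in\mathcal U$ such that, for every $k\in\{1,\dots,n\}$ and every $w\in\mathcal U$, the sum of the $k$ smallest coordinates of $u$ is at least the sum of the $k$ smallest coordinates of $w$. Moreover, these maxima $g(S;v)$ exist, $S\mapsto\mathbb E_v[g(S;v)]$ is non-negative, monotone, submodular and vanishes on $\emptyset$, i.e. it is the rank function of a polymatroid on $E$, and $\mathcal U$ is the base polytope $\mathcal B\big(\mathbb E_v[g(\cdot\,;v)]\big)$ of this polymatroid. -/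

import Mathlib

open Finset MeasureTheory

noncomputable section

namespace Persuasion

/-- `f` is the rank function of a polymatroid on the finite ground set `E`: a non-negative,
monotone, submodular set function that vanishes on the empty set. -/
structure IsPolymatroidRank {E : Type*} [DecidableEq E] (f : Finset E → ℝ) : Prop where
  empty : f ∅ = 0
  nonneg : ∀ A, 0 ≤ f A
  mono : ∀ A B, A ⊆ B → f A ≤ f B
  submodular : ∀ A B, f (A ∪ B) + f (A ∩ B) ≤ f A + f B

/-- The independence polytope `P(f)`: non-negative vectors `x` with `x(A) ≤ f(A)` for all `A`. -/
def indepPolytope {E : Type*} (f : Finset E → ℝ) : Set (E → ℝ) :=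
  {x | (∀ i, 0 ≤ x i) ∧ ∀ A : Finset E, ∑ i ∈ A, x i ≤ f A}

/-- The base polytope `B(f)`: the `x` in `P(f)` with `x(E) = f(E)`. -/
def basePolytope {E : Type*} [Fintype E] (f : Finset E → ℝ) : Set (E → ℝ) :=
  {x | x ∈ indepPolytope f ∧ ∑ i, x i = f univ}

/-- The allocations in `P(f)` that maximize the welfare `∑ i, μ i * x i`. -/
def welfareOptimal {E : Type*} [Fintype E] (f : Finset E → ℝ) (μ : E → ℝ) : Set (E → ℝ) :=
  {x | x ∈ indepPolytope f ∧ ∀ y ∈ indepPolytope f, ∑ i, μ i * y i ≤ ∑ i, μ i * x i}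

/-- The total utilities that the agents in `S` can get, for the value vector `v`, in a
welfare-optimal allocation. -/
def groupUtilities {E : Type*} [Fintype E] (f : Finset E → ℝ) (v : E → ℝ) (S : Finset E) :
    Set ℝ :=
  (fun x : E → ℝ => ∑ i ∈ S, v i * x i) '' welfareOptimal f v

/-- `g(S; v)`: the largest total utility of the agents in `S` over all welfare-optimal allocations
for the value vector `v`. -/
def saturation {E : Type*} [Fintype E] (f : Finset E → ℝ) (v : E → ℝ) (S : Finset E) : ℝ :=
  sSup (groupUtilities f v S)

/-- The expectation of `g(S; v)` when the values `v i` are drawn independently from the `D i`. -/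
def expectedSaturation {E : Type*} [Fintype E] [DecidableEq E] (f : Finset E → ℝ)
    {vals : Finset ℝ} (D : E → PMF vals) (S : Finset E) : ℝ :=
  ∑ a : E → vals, (∏ i, (D i (a i)).toReal) * saturation f (fun i => (a i : ℝ)) S

/-- A mapping rule: a finite set of signals for each agent, and for each possible value of the
agent a distribution over that agent's signals. Signals of different agents are drawn
independently. -/
structure MappingRule (E : Type*) (vals : Finset ℝ) where
  Signal : E → Type
  fintypeSignal : ∀ i, Fintype (Signal i)
  send : ∀ i, vals → PMF (Signal i)

instance {E : Type*} {vals : Finset ℝ} (M : MappingRule E vals) (i : E) :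
    Fintype (M.Signal i) := M.fintypeSignal i

/-- The full-revelation mapping rule: the signal of an agent is its realized value. -/
abbrev fullRevelation (E : Type*) (vals : Finset ℝ) : MappingRule E vals where
  Signal := fun _ => vals
  fintypeSignal := fun _ => inferInstance
  send := fun _ a => PMF.pure a

/-- The probability that agent `i` sends the signal `s`. -/
def signalProb {E : Type*} {vals : Finset ℝ} (D : E → PMF vals) (M : MappingRule E vals)
    (i : E) (s : M.Signal i) : ℝ :=
  ∑ a : vals, (D i a).toReal * (M.send i a s).toReal

/-- The probability of the signal profile `σ` (values and signals are independent across
agents). -/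
def profileProb {E : Type*} [Fintype E] {vals : Finset ℝ} (D : E → PMF vals)
    (M : MappingRule E vals) (σ : ∀ i, M.Signal i) : ℝ :=
  ∏ i, signalProb D M i (σ i)

/-- The posterior mean of the value of agent `i` after the signal `s`, by Bayes' rule
(meaningful when `s` has positive probability). -/
def posteriorMean {E : Type*} {vals : Finset ℝ} (D : E → PMF vals) (M : MappingRule E vals)
    (i : E) (s : M.Signal i) : ℝ :=
  (∑ a : vals, (D i a).toReal * (M.send i a s).toReal * (a : ℝ)) / signalProb D M i s

/-- `x` is a selection rule: it assigns a feasible allocation to each signal profile, and a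
welfare-optimal one (for the posterior means) to each profile of positive probability. -/
def IsSelectionRule {E : Type*} [Fintype E] (f : Finset E → ℝ) {vals : Finset ℝ}
    (D : E → PMF vals) (M : MappingRule E vals) (x : (∀ i, M.Signal i) → E → ℝ) : Prop :=
  ∀ σ, x σ ∈ indepPolytope f ∧
    (0 < profileProb D M σ → x σ ∈ welfareOptimal f (fun i => posteriorMean D M i (σ i)))

/-- A signaling policy all of whose realizations use the mapping rule `M`: a probability
distribution over selection rules. -/
structure Policy {E : Type*} [Fintype E] (f : Finset E → ℝ) {vals : Finset ℝ}
    (D : E → PMF vals) (M : MappingRule E vals) where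
  law : Measure ((∀ i, M.Signal i) → E → ℝ)
  isProbability : IsProbabilityMeasure law
  isSelectionRule : ∀ᵐ x ∂law, IsSelectionRule f D M x

/-- The expected utility of agent `i`; given a signal profile `σ`, its utility is its posterior
mean times its allocation. -/
def Policy.utility {E : Type*} [Fintype E] [DecidableEq E] {f : Finset E → ℝ} {vals : Finset ℝ}
    {D : E → PMF vals} {M : MappingRule E vals} (Ω : Policy f D M) (i : E) : ℝ :=
  ∫ x, ∑ σ : (∀ j, M.Signal j), profileProb D M σ * (posteriorMean D M i (σ i) * x σ i) ∂Ω.law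

/-- The set of expected utility vectors of the full-revelation signaling policies. -/
def fullRevelationUtilities {E : Type*} [Fintype E] [DecidableEq E] (f : Finset E → ℝ)
    {vals : Finset ℝ} (D : E → PMF vals) : Set (E → ℝ) :=
  Set.range fun Ω : Policy f D (fullRevelation E vals) => Ω.utility

/-- The sum of the `k` smallest coordinates of `u`. -/
def sumSmallest {E : Type*} [Fintype E] (k : ℕ) (u : E → ℝ) : ℝ :=
  (((univ.val.map u).sort (· ≤ ·)).take k).sum

/-- `u` is an `α`-majorized point of the set `U`: it lies in `U`, and for each `k` the sum of its
`k` smallest coordinates is at least `1 / α` times that of any other point of `U`. -/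
def IsMajorized {E : Type*} [Fintype E] (α : ℝ) (U : Set (E → ℝ)) (u : E → ℝ) : Prop :=
  u ∈ U ∧ ∀ k : ℕ, 1 ≤ k → k ≤ Fintype.card E → ∀ w ∈ U,
    1 / α * sumSmallest k w ≤ sumSmallest k u

end Persuasion

end

noncomputable section

namespace Persuasion

/-! ### Summation by parts along level sets -/

/-! For positive values, an allocation in `P(f)` is welfare-optimal exactly when it is tight on
every upper level set of `v` (`mem_welfareOptimal_iff`): summation by parts writes the welfare as a
positive combination of the sums over these sets, and a greedy point attains all the bounds at once.
Given this tightness, the constraints split into one contraction of `f` per value `t`. Scaling each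
by its `t`, the utility vectors form the base polytope of `weightedLevelGain`, which is therefore
the saturation function.

Averaging over `v` turns these polytopes into a weighted Minkowski sum, which is the base polytope
of the averaged rank function (`exists_decomposition_of_mem_basePolytope`): a separating functional
would contradict the greedy points. Randomizing the selection rule adds nothing, as the polytope is
cut out by linear constraints.

The majorized point is the base of least Euclidean norm. First-order optimality makes it tight on
all its lower level sets, and the sum of the `k` smallest coordinates equals `max_c (k c - ∑ i, (c -
u i)⁺)`, so those tight sets bound every other base. -/

lemma mul_sum_le_sum_mul_of_upper_sums_nonneg (T : Finset ℝ) (D : ℝ → ℝ) :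
    (∀ t ∈ T, 0 ≤ ∑ s ∈ T with t ≤ s, D s) → ∀ c : ℝ, (∀ t ∈ T, c ≤ t) →
      c * ∑ t ∈ T, D t ≤ ∑ t ∈ T, t * D t := by
  induction T using Finset.induction_on_min with
  | empty => simp
  | insert a T ha ih =>
    intro hD c hc
    have haT : a ∉ T := fun h => lt_irrefl _ (ha a h)
    have h1 : ∀ t ∈ T, 0 ≤ ∑ s ∈ T with t ≤ s, D s := by
      intro t ht
      have := hD t (mem_insert_of_mem ht)
      rwa [filter_insert, if_neg (not_le.2 (ha t ht))] at this
    have h2 := ih h1 a fun t ht => (ha t ht).le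
    have h3 := hD a (mem_insert_self _ _)
    rw [filter_true_of_mem (by
      intro s hs
      rcases mem_insert.1 hs with rfl | hs
      exacts [le_rfl, (ha s hs).le])] at h3
    have h4 := mul_le_mul_of_nonneg_right (hc a (mem_insert_self _ _)) h3
    rw [sum_insert haT] at h3 h4 ⊢
    rw [sum_insert haT]
    linarith

/-- Equality case of the previous bound: `∑ (t - c) D t` combines the upper sums with the gaps
between consecutive points as coefficients, and here all gaps are positive. -/
lemma upper_sums_eq_zero (T : Finset ℝ) (D : ℝ → ℝ) :
    (∀ t ∈ T, 0 ≤ ∑ s ∈ T with t ≤ s, D s) → ∀ c : ℝ, (∀ t ∈ T, c < t) →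
      ∑ t ∈ T, t * D t ≤ c * ∑ t ∈ T, D t → ∀ t ∈ T, ∑ s ∈ T with t ≤ s, D s = 0 := by
  induction T using Finset.induction_on_min with
  | empty => simp
  | insert a T ha ih =>
    intro hD c hc hle
    have haT : a ∉ T := fun h => lt_irrefl _ (ha a h)
    have h0 : ∀ t ∈ T, ∑ s ∈ insert a T with t ≤ s, D s = ∑ s ∈ T with t ≤ s, D s := by
      intro t ht
      rw [filter_insert, if_neg (not_le.2 (ha t ht))]
    have h1 : ∀ t ∈ T, 0 ≤ ∑ s ∈ T with t ≤ s, D s := fun t ht =>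
      h0 t ht ▸ hD t (mem_insert_of_mem ht)
    have h2 := mul_sum_le_sum_mul_of_upper_sums_nonneg T D h1 a fun t ht => (ha t ht).le
    have hall : {s ∈ insert a T | a ≤ s} = insert a T := filter_true_of_mem (by
      intro s hs
      rcases mem_insert.1 hs with rfl | hs
      exacts [le_rfl, (ha s hs).le])
    have h3 := hD a (mem_insert_self _ _)
    rw [hall] at h3
    have h4 := mul_nonneg (sub_nonneg.2 (hc a (mem_insert_self _ _)).le) h3
    have hca := hc a (mem_insert_self _ _)
    rw [sum_insert haT, sum_insert haT] at hle
    rw [sum_insert haT] at h3 h4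
    have h5 : (a - c) * (D a + ∑ t ∈ T, D t) = 0 := by linarith
    have h6 : D a + ∑ t ∈ T, D t = 0 := by
      rcases mul_eq_zero.1 h5 with h | h
      · linarith
      · exact h
    intro t ht
    rcases mem_insert.1 ht with rfl | ht
    · rw [hall, sum_insert haT, h6]
    · rw [h0 t ht]
      refine ih h1 a ha ?_ t ht
      linarith

section Levels

variable {E : Type*} [Fintype E]

lemma sum_fiber_sums (w d : E → ℝ) (p : ℝ → Prop) [DecidablePred p] :
    ∑ s ∈ univ.image w with p s, ∑ i with w i = s, d i = ∑ i with p (w i), d i := by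
  rw [← sum_fiberwise_of_maps_to (s := univ.filter fun i => p (w i))
    (t := (univ.image w).filter p) (g := w) (by simp)]
  refine sum_congr rfl fun s hs => sum_congr ?_ fun _ _ => rfl
  ext i
  simp only [mem_filter, mem_univ, true_and] at hs ⊢
  exact ⟨fun h => ⟨h ▸ hs.2, h⟩, fun h => h.2⟩

lemma sum_fiber (v x : E → ℝ) (S : Finset E) :
    ∑ t ∈ univ.image v, ∑ i ∈ S with v i = t, x i = ∑ i ∈ S, x i :=
  sum_fiberwise_of_maps_to (by simp) _

lemma sum_mul_fiber (v x : E → ℝ) (S : Finset E) :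
    ∑ t ∈ univ.image v, t * ∑ i ∈ S with v i = t, x i = ∑ i ∈ S, v i * x i := by
  rw [← sum_fiber v]
  refine sum_congr rfl fun s _ => ?_
  rw [mul_sum]
  refine sum_congr rfl fun i hi => ?_
  rw [(mem_filter.1 hi).2]

lemma mul_sum_le_of_level_sums_nonneg (w d : E → ℝ)
    (hd : ∀ t, 0 ≤ ∑ i with t ≤ w i, d i) (c : ℝ) (hc : ∀ i, c ≤ w i) :
    c * ∑ i, d i ≤ ∑ i, w i * d i := by
  rw [← sum_mul_fiber w, ← sum_fiber w d]
  refine mul_sum_le_sum_mul_of_upper_sums_nonneg _ _ (fun t _ => ?_) c (by simpa using hc)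
  rw [sum_fiber_sums w d fun s => t ≤ s]
  exact hd t

lemma level_sums_eq_zero (w d : E → ℝ)
    (hd : ∀ t, 0 ≤ ∑ i with t ≤ w i, d i) (c : ℝ) (hc : ∀ i, c < w i)
    (hle : ∑ i, w i * d i ≤ c * ∑ i, d i) (t : ℝ) : ∑ i with t ≤ w i, d i = 0 := by
  rw [← sum_mul_fiber w, ← sum_fiber w d] at hle
  have key := upper_sums_eq_zero _ _ (fun t _ => by
    rw [sum_fiber_sums w d fun s => t ≤ s]
    exact hd t) c (by simpa using hc) hle
  rcases (univ.filter fun i => t ≤ w i).eq_empty_or_nonempty with h | h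
  · rw [h, sum_empty]
  · obtain ⟨j, hj, hmin⟩ := exists_min_image _ w h
    have := key (w j) (mem_image_of_mem w (mem_univ j))
    rw [sum_fiber_sums w d fun s => w j ≤ s] at this
    rw [← this]
    refine sum_congr ?_ fun _ _ => rfl
    ext i
    simp only [mem_filter, mem_univ, true_and] at hj hmin ⊢
    exact ⟨hmin i, hj.trans⟩

lemma filter_lt_eq_empty_or_level (w : E → ℝ) (t : ℝ) :
    (univ.filter fun i => t < w i) = ∅ ∨
      ∃ s, (univ.filter fun i => t < w i) = univ.filter fun i => s ≤ w i := by
  refine (eq_empty_or_nonempty _).imp_right fun h => ?_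
  obtain ⟨j, hj, hmin⟩ := exists_min_image _ w h
  refine ⟨w j, ?_⟩
  ext i
  simp only [mem_filter, mem_univ, true_and] at hj hmin ⊢
  exact ⟨hmin i, hj.trans_le⟩

lemma exists_lt_all (w : E → ℝ) : ∃ c, ∀ i, c < w i := by
  obtain ⟨c, hc⟩ := (Set.finite_range w).bddBelow
  exact ⟨c - 1, fun i => by linarith [hc ⟨i, rfl⟩]⟩

lemma disjoint_filter_lt (v : E → ℝ) (t : ℝ) (S : Finset E) :
    Disjoint (univ.filter fun i => t < v i) (S.filter fun i => v i = t) := by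
  rw [disjoint_left]
  intro i hi hi'
  exact (mem_filter.1 hi).2.ne' (mem_filter.1 hi').2

lemma sum_levels_telescope (h : Finset E → ℝ) (h0 : h ∅ = 0) (v : E → ℝ) (S : Finset E) :
    ∑ t ∈ univ.image v, (h (S.filter fun i => t ≤ v i) - h (S.filter fun i => t < v i)) = h S := by
  -- The threshold `c` stays free: removing the least level `a` leaves the same claim at threshold
  -- `a`.
  have key : ∀ T : Finset ℝ, (∀ c, (∀ i ∈ S, c < v i → v i ∈ T) → (∀ t ∈ T, c < t) →
      ∑ t ∈ T, (h (S.filter fun i => t ≤ v i) - h (S.filter fun i => t < v i))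
        = h (S.filter fun i => c < v i)) := by
    intro T
    induction T using Finset.induction_on_min with
    | empty =>
      intro c hc _
      rw [filter_false_of_mem fun i hi h => by simpa using hc i hi h, h0, sum_empty]
    | insert a T ha ih =>
      intro c hc hcT
      rw [sum_insert fun h => lt_irrefl _ (ha a h), ih a _ ha]
      · rw [sub_add_cancel]
        congr 1
        refine filter_congr fun i hi => ⟨(hcT a (mem_insert_self _ _)).trans_le, fun h => ?_⟩
        rcases mem_insert.1 (hc i hi h) with h | h
        exacts [h.ge, (ha _ h).le]
      · intro i hi h
        exact (mem_insert.1 (hc i hi ((hcT a (mem_insert_self _ _)).trans h))).resolve_left h.ne'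
  obtain ⟨c, hc⟩ := exists_lt_all v
  rw [key _ c (by simp) (by simpa using hc), filter_true_of_mem fun i _ => hc i]

end Levels

/-! ### Greedy points of base polytopes -/

section Greedy

variable {E : Type*} [DecidableEq E] {f : Finset E → ℝ}

/-- Elements enter in order of decreasing weight, each receiving its marginal rank. Upper level sets
are then prefixes of the order, where the marginals telescope; submodularity gives feasibility. -/
lemma IsPolymatroidRank.exists_greedy (hf : IsPolymatroidRank f) (w : E → ℝ) (A : Finset E) :
    ∃ x : E → ℝ, (∀ i, 0 ≤ x i) ∧ (∀ i ∉ A, x i = 0) ∧ (∀ B ⊆ A, ∑ i ∈ B, x i ≤ f B) ∧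
      ∑ i ∈ A, x i = f A ∧
      ∀ t, ∑ i ∈ A with t ≤ w i, x i = f {i ∈ A | t ≤ w i} := by
  induction A using Finset.induction_on_min_value w with
  | empty => exact ⟨0, by simp, by simp, by simp [hf.empty], by simp [hf.empty], by simp [hf.empty]⟩
  | insert a A haA hmin ih =>
    obtain ⟨x, hx0, hxA, hxB, hxt, hxl⟩ := ih
    have hsum : ∀ B ⊆ A, ∑ i ∈ B, Function.update x a (f (insert a A) - f A) i = ∑ i ∈ B, x i :=
      fun B hB => sum_update_of_notMem (fun h => haA (hB h)) _ _
    have htot : ∑ i ∈ insert a A, Function.update x a (f (insert a A) - f A) i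
        = f (insert a A) := by
      rw [sum_insert haA, hsum A subset_rfl, hxt, Function.update_self]
      ring
    refine ⟨Function.update x a (f (insert a A) - f A), fun i => ?_, fun i hi => ?_,
      fun B hB => ?_, htot, fun t => ?_⟩
    · rcases eq_or_ne i a with rfl | h
      · rw [Function.update_self]
        exact sub_nonneg.2 (hf.mono _ _ (subset_insert _ _))
      · rw [Function.update_of_ne h]
        exact hx0 i
    · rw [mem_insert, not_or] at hi
      rw [Function.update_of_ne hi.1, hxA i hi.2]
    · by_cases haB : a ∈ B
      · have hBA : B.erase a ⊆ A := fun i hi => by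
          have := hB (mem_of_mem_erase hi)
          exact (mem_insert.1 this).resolve_left (ne_of_mem_erase hi)
        have h1 : B ∪ A = insert a A := by
          ext i
          have := @hB i
          simp only [mem_union, mem_insert] at this ⊢
          constructor
          · rintro (h | h)
            exacts [this h, Or.inr h]
          · rintro (rfl | h)
            exacts [Or.inl haB, Or.inr h]
        have h2 : B ∩ A = B.erase a := by
          ext i
          simp only [mem_inter, mem_erase]
          constructor
          · rintro ⟨h, h'⟩
            exact ⟨fun e => haA (e ▸ h'), h⟩
          · rintro ⟨h, h'⟩
            exact ⟨h', hBA (mem_erase.2 ⟨h, h'⟩)⟩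
        have h3 := hf.submodular B A
        rw [h1, h2] at h3
        rw [← add_sum_erase B _ haB, hsum _ hBA, Function.update_self]
        linarith [hxB _ hBA]
      · have hBA : B ⊆ A := fun i hi =>
          (mem_insert.1 (hB hi)).resolve_left fun e => haB (e ▸ hi)
        rw [hsum B hBA]
        exact hxB B hBA
    · by_cases ht : t ≤ w a
      · rw [filter_true_of_mem (s := insert a A) (by
          intro s hs
          rcases mem_insert.1 hs with rfl | hs
          exacts [ht, ht.trans (hmin s hs)]), htot]
      · rw [filter_insert, if_neg ht, hsum _ (filter_subset _ _), hxl]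

/-- For every weight there is a base that is tight on all upper level sets of the weight. -/
lemma IsPolymatroidRank.exists_base_tight [Fintype E] (hf : IsPolymatroidRank f) (w : E → ℝ) :
    ∃ x ∈ basePolytope f, ∀ t, ∑ i with t ≤ w i, x i = f {i | t ≤ w i} := by
  obtain ⟨x, h0, -, hB, ht, hl⟩ := hf.exists_greedy w univ
  exact ⟨x, ⟨⟨h0, fun A => hB A (subset_univ A)⟩, ht⟩, hl⟩

end Greedy

/-! ### Base polytopes are convex and compact -/

section Base

variable {E : Type*} [Fintype E]

lemma convex_basePolytope (f : Finset E → ℝ) : Convex ℝ (basePolytope f) := by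
  rintro x ⟨⟨hx0, hxA⟩, hx⟩ y ⟨⟨hy0, hyA⟩, hy⟩ a b ha hb hab
  have hs : ∀ A : Finset E, ∑ i ∈ A, (a • x + b • y) i
      = a * ∑ i ∈ A, x i + b * ∑ i ∈ A, y i := fun A => by
    simp [sum_add_distrib, mul_sum]
  refine ⟨⟨fun i => ?_, fun A => ?_⟩, ?_⟩
  · have := hx0 i
    have := hy0 i
    simp only [Pi.add_apply, Pi.smul_apply, smul_eq_mul]
    positivity
  · rw [hs]
    calc _ ≤ a * f A + b * f A := by gcongr <;> [exact hxA A; exact hyA A]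
      _ = f A := by rw [← add_mul, hab, one_mul]
  · rw [hs, hx, hy, ← add_mul, hab, one_mul]

lemma isCompact_basePolytope (f : Finset E → ℝ) : IsCompact (basePolytope f) := by
  have hc : IsClosed (basePolytope f) := by
    have : basePolytope f = (⋂ i, {x | 0 ≤ x i}) ∩ (⋂ A : Finset E, {x | ∑ i ∈ A, x i ≤ f A}) ∩
        {x | ∑ i, x i = f univ} := by
      ext x
      simp [basePolytope, indepPolytope]
    rw [this]
    refine ((isClosed_iInter fun i => ?_).inter (isClosed_iInter fun A => ?_)).inter ?_
    · exact isClosed_le continuous_const (continuous_apply i)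
    · exact isClosed_le (by fun_prop) continuous_const
    · exact isClosed_eq (by fun_prop) continuous_const
  refine (isCompact_Icc (a := (0 : E → ℝ)) (b := fun i => f {i})).of_isClosed_subset hc ?_
  rintro x ⟨⟨h0, hA⟩, -⟩
  exact ⟨h0, fun i => by simpa using hA {i}⟩

/-- A base that maximizes a linear functional over the base polytope is tight on all upper level
sets of the functional. -/
lemma IsPolymatroidRank.tight_of_max [DecidableEq E] {f : Finset E → ℝ}
    (hf : IsPolymatroidRank f) (w x : E → ℝ) (hx : x ∈ basePolytope f)
    (hmax : ∀ y ∈ basePolytope f, ∑ i, w i * y i ≤ ∑ i, w i * x i) (t : ℝ) :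
    ∑ i with t ≤ w i, x i = f {i | t ≤ w i} := by
  obtain ⟨y, hy, hyt⟩ := hf.exists_base_tight w
  obtain ⟨c, hc⟩ := exists_lt_all w
  -- Bases have equal totals, so any strict lower bound `c` of the weights serves.
  have := level_sums_eq_zero w (fun i => y i - x i) (fun t => by
      rw [sum_sub_distrib, hyt]
      exact sub_nonneg.2 (hx.1.2 _)) c hc (by
      simp only [mul_sub, sum_sub_distrib, hy.2, hx.2, sub_self, mul_zero]
      exact sub_nonpos.2 (hmax y hy)) t
  rw [sum_sub_distrib, hyt] at this
  linarith

end Base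

/-! ### Welfare-optimal allocations -/

section Sum

variable {E : Type*} [DecidableEq E]

lemma IsPolymatroidRank.sum_mul {ι : Type*} (T : Finset ι) (p : ι → ℝ) (g : ι → Finset E → ℝ)
    (hp : ∀ a ∈ T, 0 ≤ p a) (hg : ∀ a ∈ T, IsPolymatroidRank (g a)) :
    IsPolymatroidRank fun S => ∑ a ∈ T, p a * g a S where
  empty := sum_eq_zero fun a ha => by rw [(hg a ha).empty, mul_zero]
  nonneg A := sum_nonneg fun a ha => mul_nonneg (hp a ha) ((hg a ha).nonneg A)
  mono A B h := sum_le_sum fun a ha => mul_le_mul_of_nonneg_left ((hg a ha).mono A B h) (hp a ha)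
  submodular A B := by
    rw [← sum_add_distrib, ← sum_add_distrib]
    refine sum_le_sum fun a ha => ?_
    rw [← mul_add, ← mul_add]
    exact mul_le_mul_of_nonneg_left ((hg a ha).submodular A B) (hp a ha)

end Sum

section Welfare

variable {E : Type*} [Fintype E] [DecidableEq E] {f : Finset E → ℝ} {v : E → ℝ}

/-- The marginal rank of the agents in `S` of value exactly `t`, on top of all agents of value
more than `t`. -/
def levelGain (f : Finset E → ℝ) (v : E → ℝ) (t : ℝ) (S : Finset E) : ℝ :=
  f ((univ.filter fun i => t < v i) ∪ S.filter fun i => v i = t) - f {i | t < v i}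

/-- The closed form of the saturation function. -/
def weightedLevelGain (f : Finset E → ℝ) (v : E → ℝ) (S : Finset E) : ℝ :=
  ∑ t ∈ univ.image v, t * levelGain f v t S

lemma isPolymatroidRank_levelGain (hf : IsPolymatroidRank f) (v : E → ℝ) (t : ℝ) :
    IsPolymatroidRank (levelGain f v t) where
  empty := by simp [levelGain]
  nonneg A := sub_nonneg.2 (hf.mono _ _ subset_union_left)
  mono A B h := sub_le_sub_right
    (hf.mono _ _ (union_subset_union_right (filter_subset_filter _ h))) _
  submodular A B := by
    have h := hf.submodular ((univ.filter fun i => t < v i) ∪ A.filter fun i => v i = t)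
      ((univ.filter fun i => t < v i) ∪ B.filter fun i => v i = t)
    rw [← union_union_distrib_left, ← union_inter_distrib_left, ← filter_union,
      ← filter_inter_distrib] at h
    simp only [levelGain]
    linarith

lemma isPolymatroidRank_weightedLevelGain (hf : IsPolymatroidRank f) (hv : ∀ i, 0 < v i) :
    IsPolymatroidRank (weightedLevelGain f v) :=
  IsPolymatroidRank.sum_mul _ _ _ (by simpa using fun i => (hv i).le)
    fun t _ => isPolymatroidRank_levelGain hf v t

lemma mem_welfareOptimal_iff (hf : IsPolymatroidRank f) (hv : ∀ i, 0 < v i) (x : E → ℝ) :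
    x ∈ welfareOptimal f v ↔
      x ∈ indepPolytope f ∧ ∀ t, ∑ i with t ≤ v i, x i = f {i | t ≤ v i} := by
  refine and_congr_right fun hx => ⟨fun hopt t => ?_, fun ht y hy => ?_⟩
  · obtain ⟨y, hy, hyt⟩ := hf.exists_base_tight v
    -- The totals of `x` and `y` are not known to agree, so `c = 0` is needed; this is where
    -- positivity of the values enters.
    have := level_sums_eq_zero v (fun i => y i - x i) (fun t => by
      rw [sum_sub_distrib, hyt]
      exact sub_nonneg.2 (hx.2 _)) 0 hv (by
      rw [zero_mul]
      simp only [mul_sub, sum_sub_distrib]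
      exact sub_nonpos.2 (hopt y hy.1)) t
    rw [sum_sub_distrib, hyt] at this
    linarith
  · have := mul_sum_le_of_level_sums_nonneg v (fun i => x i - y i) (fun t => by
      rw [sum_sub_distrib, ht]
      exact sub_nonneg.2 (hy.2 _)) 0 fun i => (hv i).le
    simp only [mul_sub, sum_sub_distrib, zero_mul] at this
    linarith

lemma sum_lt_of_tight (hf : IsPolymatroidRank f) {x : E → ℝ}
    (hx : ∀ t, ∑ i with t ≤ v i, x i = f {i | t ≤ v i}) (t : ℝ) :
    ∑ i with t < v i, x i = f {i | t < v i} := by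
  rcases filter_lt_eq_empty_or_level v t with h | ⟨s, h⟩
  · rw [h, sum_empty, hf.empty]
  · rw [h, hx]

lemma filter_lt_union_eq (v : E → ℝ) (t : ℝ) :
    ((univ.filter fun i => t < v i) ∪ univ.filter fun i => v i = t)
      = univ.filter fun i => t ≤ v i := by
  ext i
  simp [le_iff_lt_or_eq, eq_comm]

/-- Tightness on `{t < v}` lets its mass be subtracted from the constraint on its union with a part
of level `t`, which leaves the constraint of the contraction. -/
lemma mul_mem_basePolytope_of_welfareOptimal (hf : IsPolymatroidRank f) (hv : ∀ i, 0 < v i)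
    {x : E → ℝ} (hx : x ∈ welfareOptimal f v) :
    (fun i => v i * x i) ∈ basePolytope (weightedLevelGain f v) := by
  rw [mem_welfareOptimal_iff hf hv] at hx
  obtain ⟨⟨h0, hA⟩, ht⟩ := hx
  have key : ∀ t (S : Finset E), f {i | t < v i} + ∑ i ∈ S with v i = t, x i
      = ∑ i ∈ (univ.filter fun i => t < v i) ∪ S.filter fun i => v i = t, x i := fun t S => by
    rw [sum_union (disjoint_filter_lt v t S), sum_lt_of_tight hf ht]
  refine ⟨⟨fun i => mul_nonneg (hv i).le (h0 i), fun S => ?_⟩, ?_⟩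
  · rw [← sum_mul_fiber]
    refine sum_le_sum fun t htv => ?_
    obtain ⟨j, -, rfl⟩ := mem_image.1 htv
    refine mul_le_mul_of_nonneg_left ?_ (hv j).le
    rw [levelGain, le_sub_iff_add_le', key]
    exact hA _
  · rw [← sum_mul_fiber]
    refine sum_congr rfl fun t _ => ?_
    rw [levelGain, eq_sub_of_add_eq' (key t univ), filter_lt_union_eq, ht]

lemma weightedLevelGain_fiber (v : E → ℝ) {t : ℝ} (ht : t ∈ univ.image v) (S : Finset E) :
    weightedLevelGain f v (S.filter fun i => v i = t) = t * levelGain f v t S := by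
  rw [weightedLevelGain, sum_eq_single_of_mem t ht]
  · rw [levelGain, levelGain, filter_filter]
    simp
  · intro s _ hst
    rw [levelGain, filter_filter, filter_false_of_mem (s := S)]
    · simp
    · rintro i - ⟨h, h'⟩
      exact hst (h'.symm.trans h)

lemma levelGain_le (hf : IsPolymatroidRank f) (v : E → ℝ) (t : ℝ) (S : Finset E) :
    levelGain f v t S ≤ f (S.filter fun i => t ≤ v i) - f (S.filter fun i => t < v i) := by
  have h := hf.submodular (S.filter fun i => t ≤ v i) (univ.filter fun i => t < v i)
  have h1 : (S.filter fun i => t ≤ v i) ∪ (univ.filter fun i => t < v i)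
      = (univ.filter fun i => t < v i) ∪ S.filter fun i => v i = t := by
    ext i
    simp only [mem_union, mem_filter, mem_univ, true_and, le_iff_lt_or_eq, eq_comm (a := t)]
    tauto
  have h2 : (S.filter fun i => t ≤ v i) ∩ (univ.filter fun i => t < v i)
      = S.filter fun i => t < v i := by
    ext i
    simp only [mem_inter, mem_filter, mem_univ, true_and]
    exact ⟨fun h => ⟨h.1.1, h.2⟩, fun h => ⟨⟨h.1, h.2.le⟩, h.2⟩⟩
  rw [h1, h2] at h
  rw [levelGain]
  linarith

lemma levelGain_level (v : E → ℝ) (t s : ℝ) :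
    levelGain f v t {i | s ≤ v i} = f ({i ∈ univ.filter fun i => s ≤ v i | t ≤ v i})
      - f ({i ∈ univ.filter fun i => s ≤ v i | t < v i}) := by
  rw [levelGain, filter_filter, filter_filter, filter_filter]
  rcases le_or_gt s t with h | h
  · have h1 : (univ.filter fun i => s ≤ v i ∧ v i = t) = univ.filter fun i => v i = t :=
      filter_congr fun i _ => ⟨fun h => h.2, fun h' => ⟨h' ▸ h, h'⟩⟩
    have h2 : (univ.filter fun i => s ≤ v i ∧ t ≤ v i) = univ.filter fun i => t ≤ v i :=
      filter_congr fun i _ => ⟨fun h => h.2, fun h' => ⟨h.trans h', h'⟩⟩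
    have h3 : (univ.filter fun i => s ≤ v i ∧ t < v i) = univ.filter fun i => t < v i :=
      filter_congr fun i _ => ⟨fun h => h.2, fun h' => ⟨h.trans h'.le, h'⟩⟩
    rw [h1, h2, h3, filter_lt_union_eq]
  · have h1 : (univ.filter fun i => s ≤ v i ∧ v i = t) = ∅ :=
      filter_false_of_mem fun i _ h' => absurd (h'.2 ▸ h'.1) (not_le.2 h)
    have h2 : (univ.filter fun i => s ≤ v i ∧ t ≤ v i) = univ.filter fun i => s ≤ v i :=
      filter_congr fun i _ => ⟨fun h => h.1, fun h' => ⟨h', h.le.trans h'⟩⟩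
    have h3 : (univ.filter fun i => s ≤ v i ∧ t < v i) = univ.filter fun i => s ≤ v i :=
      filter_congr fun i _ => ⟨fun h => h.1, fun h' => ⟨h', h.trans_le h'⟩⟩
    rw [h1, h2, h3, union_empty, sub_self, sub_self]

/-- Level by level, `y / v` obeys the contracted constraints. By diminishing marginals
(`levelGain_le`) these sum to at most the telescoping `f S`, with equality on upper level sets. -/
lemma div_mem_welfareOptimal (hf : IsPolymatroidRank f) (hv : ∀ i, 0 < v i)
    {y : E → ℝ} (hy : y ∈ basePolytope (weightedLevelGain f v)) :
    (fun i => y i / v i) ∈ welfareOptimal f v := by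
  obtain ⟨⟨h0, hA⟩, hE⟩ := hy
  have hpos : ∀ t ∈ univ.image v, 0 < t := by simpa using hv
  have hle : ∀ t ∈ univ.image v, ∀ S : Finset E,
      ∑ i ∈ S with v i = t, y i ≤ t * levelGain f v t S := fun t ht S =>
    weightedLevelGain_fiber (f := f) v ht S ▸ hA _
  -- Termwise inequalities whose totals agree are equalities.
  have heq : ∀ t ∈ univ.image v, ∑ i with v i = t, y i = t * levelGain f v t univ := by
    refine (sum_eq_sum_iff_of_le fun t ht => hle t ht univ).1 ?_
    rw [sum_fiber, hE, weightedLevelGain]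
  have hdiv : ∀ t (S : Finset E),
      ∑ i ∈ S with v i = t, y i / v i = (∑ i ∈ S with v i = t, y i) / t := fun t S => by
    rw [sum_div]
    exact sum_congr rfl fun i hi => by rw [(mem_filter.1 hi).2]
  have hxle : ∀ t ∈ univ.image v, ∀ S : Finset E,
      ∑ i ∈ S with v i = t, y i / v i ≤ levelGain f v t S := fun t ht S => by
    rw [hdiv, div_le_iff₀' (hpos t ht)]
    exact hle t ht S
  have hxeq : ∀ t ∈ univ.image v, ∑ i with v i = t, y i / v i = levelGain f v t univ :=
    fun t ht => by rw [hdiv, heq t ht, mul_div_cancel_left₀ _ (hpos t ht).ne']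
  rw [mem_welfareOptimal_iff hf hv]
  refine ⟨⟨fun i => div_nonneg (h0 i) (hv i).le, fun S => ?_⟩, fun s => ?_⟩
  · rw [← sum_fiber v, ← sum_levels_telescope f hf.empty v S]
    exact sum_le_sum fun t ht => (hxle t ht S).trans (levelGain_le hf v t S)
  · rw [← sum_fiber v, ← sum_levels_telescope f hf.empty v]
    refine sum_congr rfl fun t ht => ?_
    rw [← levelGain_level]
    rcases le_or_gt s t with h | h
    · have h1 : ({i ∈ univ.filter fun i => s ≤ v i | v i = t}) = univ.filter fun i => v i = t := by
        rw [filter_filter]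
        exact filter_congr fun i _ => ⟨fun h => h.2, fun h' => ⟨h' ▸ h, h'⟩⟩
      rw [levelGain, h1, hxeq t ht, levelGain]
    · have h1 : ({i ∈ univ.filter fun i => s ≤ v i | v i = t}) = ∅ := by
        rw [filter_filter]
        exact filter_false_of_mem fun i _ h' => absurd (h'.2 ▸ h'.1) (not_le.2 h)
      rw [levelGain, h1, union_empty, sub_self, sum_empty]

lemma isGreatest_weightedLevelGain (hf : IsPolymatroidRank f) (hv : ∀ i, 0 < v i)
    (S : Finset E) : IsGreatest (groupUtilities f v S) (weightedLevelGain f v S) := by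
  constructor
  -- The indicator of `S` has `S` as its upper level set at 1, so the greedy base is tight on `S`.
  · obtain ⟨y, hy, ht⟩ := (isPolymatroidRank_weightedLevelGain hf hv).exists_base_tight
      fun i => if i ∈ S then 1 else 0
    have h1 : (univ.filter fun i => (1 : ℝ) ≤ if i ∈ S then 1 else 0) = S := by
      ext i
      by_cases h : i ∈ S <;> simp [h]
    have h2 := ht 1
    rw [h1] at h2
    refine ⟨_, div_mem_welfareOptimal hf hv hy, ?_⟩
    rw [← h2]
    exact sum_congr rfl fun i _ => mul_div_cancel₀ _ (hv i).ne'
  · rintro _ ⟨x, hx, rfl⟩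
    exact (mul_mem_basePolytope_of_welfareOptimal hf hv hx).1.2 S

lemma saturation_eq_weightedLevelGain (hf : IsPolymatroidRank f) (hv : ∀ i, 0 < v i) :
    saturation f v = weightedLevelGain f v :=
  funext fun S => (isGreatest_weightedLevelGain hf hv S).csSup_eq

lemma isPolymatroidRank_saturation (hf : IsPolymatroidRank f) (hv : ∀ i, 0 < v i) :
    IsPolymatroidRank (saturation f v) :=
  saturation_eq_weightedLevelGain hf hv ▸ isPolymatroidRank_weightedLevelGain hf hv

end Welfare

/-! ### Weighted Minkowski sums of base polytopes -/

section Minkowski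

variable {E : Type*} [Fintype E] [DecidableEq E] {ι : Type*} [Fintype ι]

lemma exists_decomposition_of_mem_basePolytope (p : ι → ℝ) (g : ι → Finset E → ℝ)
    (hg : ∀ a, IsPolymatroidRank (g a)) {z : E → ℝ}
    (hz : z ∈ basePolytope fun S => ∑ a, p a * g a S) :
    ∃ y : ι → E → ℝ, (∀ a, y a ∈ basePolytope (g a)) ∧ ∑ a, p a • y a = z := by
  set B : Set (ι → E → ℝ) := Set.univ.pi fun a => basePolytope (g a)
  let T : (ι → E → ℝ) →ₗ[ℝ] (E → ℝ) := ∑ a, p a • LinearMap.proj a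
  have hT : ∀ y, T y = ∑ a, p a • y a := fun y => by simp [T]
  have hBc : IsCompact B := isCompact_univ_pi fun a => isCompact_basePolytope _
  have hBv : Convex ℝ B := convex_pi fun a _ => convex_basePolytope _
  by_contra hcon
  have hzB : z ∉ T '' B := by
    rintro ⟨y, hy, hyz⟩
    exact hcon ⟨y, fun a => hy a trivial, by rw [← hT, hyz]⟩
  obtain ⟨φ, r, hφB, hφz⟩ := geometric_hahn_banach_closed_point (hBv.linear_image T)
    (hBc.image T.continuous_of_finiteDimensional).isClosed hzB
  let w : E → ℝ := fun i => φ (Pi.single i 1)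
  have hφ : ∀ x : E → ℝ, φ x = ∑ i, w i * x i := fun x => by
    conv_lhs => rw [pi_eq_sum_univ' x]
    rw [map_sum]
    refine sum_congr rfl fun i _ => ?_
    rw [map_smul, smul_eq_mul, mul_comm]
  -- Greedy bases for the same `w` are tight on the same level sets, so their weighted sum `T y`
  -- attains the bounds that `z` obeys there; hence `φ z ≤ φ (T y)`.
  choose y hy hyt using fun a => (hg a).exists_base_tight w
  have hsum : ∀ A : Finset E, ∑ i ∈ A, T y i = ∑ a, p a * ∑ i ∈ A, y a i := fun A => by
    simp only [hT, Finset.sum_apply, Pi.smul_apply, smul_eq_mul, mul_sum]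
    exact sum_comm
  obtain ⟨c, hc⟩ := exists_lt_all w
  have key := mul_sum_le_of_level_sums_nonneg w (fun i => T y i - z i) (fun t => by
    rw [sum_sub_distrib, hsum]
    simp only [hyt]
    exact sub_nonneg.2 (hz.1.2 _)) c fun i => (hc i).le
  simp only [mul_sub, sum_sub_distrib] at key
  have hE : ∑ i, T y i = ∑ i, z i := by
    rw [hsum, hz.2]
    exact sum_congr rfl fun a _ => by rw [(hy a).2]
  rw [hE, ← hφ, ← hφ] at key
  have := hφB _ ⟨y, fun a _ => hy a, rfl⟩
  linarith

end Minkowski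

/-! ### Majorized points of base polytopes -/

section Majorized

variable {E : Type*} [Fintype E]

lemma sum_sorted (u : E → ℝ) (φ : ℝ → ℝ) :
    (((univ.val.map u).sort (· ≤ ·)).map φ).sum = ∑ i, φ (u i) := by
  rw [← Multiset.sum_coe, ← Multiset.map_coe, Multiset.sort_eq, Multiset.map_map]
  rfl

lemma list_sum_map_sub (l : List ℝ) (c : ℝ) :
    (l.map fun x => c - x).sum = l.length * c - l.sum := by
  induction l with
  | nil => simp
  | cons a l ih =>
    simp only [List.map_cons, List.sum_cons, ih, List.length_cons]
    push_cast
    ring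

lemma length_sorted (u : E → ℝ) :
    ((univ.val.map u).sort (· ≤ ·)).length = Fintype.card E := by
  simp

lemma sub_sum_max_le_sumSmallest (u : E → ℝ) {k : ℕ} (hk : k ≤ Fintype.card E) (c : ℝ) :
    k * c - ∑ i, max (c - u i) 0 ≤ sumSmallest k u := by
  rw [← sum_sorted u fun x => max (c - x) 0, sumSmallest]
  have hl := length_sorted u
  generalize (univ.val.map u).sort (· ≤ ·) = l at hl ⊢
  have h1 : (l.map fun x => max (c - x) 0).sum
      = ((l.take k).map fun x => max (c - x) 0).sum
        + ((l.drop k).map fun x => max (c - x) 0).sum := by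
    rw [← List.sum_append, ← List.map_append, List.take_append_drop]
  have h2 : ((l.take k).map fun x => c - x).sum
      ≤ ((l.take k).map fun x => max (c - x) 0).sum :=
    List.sum_le_sum fun x _ => le_max_left _ _
  have h3 : 0 ≤ ((l.drop k).map fun x => max (c - x) 0).sum :=
    List.sum_nonneg fun x hx => by
      obtain ⟨y, -, rfl⟩ := List.mem_map.1 hx
      exact le_max_right _ _
  rw [list_sum_map_sub, List.length_take, min_eq_left (by omega)] at h2
  linarith

lemma exists_sumSmallest_le (u : E → ℝ) {k : ℕ} (hk1 : 1 ≤ k) (hk : k ≤ Fintype.card E) :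
    ∃ c, sumSmallest k u ≤ k * c - ∑ i, max (c - u i) 0 := by
  have hs : ((univ.val.map u).sort (· ≤ ·)).Pairwise (· ≤ ·) := Multiset.pairwise_sort _ _
  simp only [fun c => (sum_sorted u fun x => max (c - x) 0).symm, sumSmallest]
  have hl := length_sorted u
  generalize (univ.val.map u).sort (· ≤ ·) = l at hl hs ⊢
  have hmono : ∀ i j (hi : i < l.length) (hj : j < l.length), i ≤ j → l[i] ≤ l[j] := by
    intro i j hi hj hij
    rcases hij.eq_or_lt with rfl | h
    · exact le_rfl
    · exact List.pairwise_iff_getElem.1 hs i j hi hj h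
  have hkl : k - 1 < l.length := by omega
  -- The `k`-th smallest coordinate: the positive parts vanish after it and are exact up to it.
  refine ⟨l[k - 1], ?_⟩
  set c := l[k - 1] with hc
  have h1 : (l.map fun x => max (c - x) 0).sum
      = ((l.take k).map fun x => max (c - x) 0).sum
        + ((l.drop k).map fun x => max (c - x) 0).sum := by
    rw [← List.sum_append, ← List.map_append, List.take_append_drop]
  have h2 : (l.take k).map (fun x => max (c - x) 0) = (l.take k).map fun x => c - x := by
    refine List.map_congr_left fun x hx => max_eq_left ?_
    obtain ⟨i, hi, rfl⟩ := List.mem_iff_getElem.1 hx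
    rw [List.length_take] at hi
    rw [List.getElem_take, sub_nonneg]
    exact hmono _ _ _ _ (by omega)
  have h3 : ((l.drop k).map fun x => max (c - x) 0).sum = 0 := by
    refine List.sum_eq_zero fun x hx => ?_
    obtain ⟨y, hy, rfl⟩ := List.mem_map.1 hx
    refine max_eq_right ?_
    obtain ⟨i, hi, rfl⟩ := List.mem_iff_getElem.1 hy
    rw [List.length_drop] at hi
    rw [List.getElem_drop, sub_nonpos]
    exact hmono _ _ _ _ (by omega)
  rw [h1, h2, h3, list_sum_map_sub, List.length_take, min_eq_left (by omega)]
  linarith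

lemma exists_first_order_min {K : Set (E → ℝ)} (hK : IsCompact K) (hKc : Convex ℝ K)
    (hne : K.Nonempty) : ∃ u ∈ K, ∀ w ∈ K, ∑ i, u i * u i ≤ ∑ i, u i * w i := by
  obtain ⟨u, hu, hmin⟩ := hK.exists_isMinOn hne
    (f := fun x : E → ℝ => ∑ i, x i ^ 2) (by fun_prop)
  refine ⟨u, hu, fun w hw => ?_⟩
  by_contra! hlt
  set s := ∑ i, u i * (w i - u i) with hs
  have hs0 : s < 0 := by
    simp only [hs, mul_sub, sum_sub_distrib]
    linarith
  set Q := ∑ i, (w i - u i) ^ 2 with hQ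
  have hQ0 : 0 ≤ Q := sum_nonneg fun i _ => sq_nonneg _
  have hQs : 0 < Q - s := by linarith
  -- With this step length `2 * s + t * Q = s * (1 + t)`, which is negative; the denominator is
  -- positive even if `Q = 0`.
  set t := -s / (Q - s) with ht
  have ht0 : 0 < t := div_pos (by linarith) hQs
  have ht1 : t ≤ 1 := (div_le_one hQs).2 (by linarith)
  have hmem : u + t • (w - u) ∈ K := hKc.add_smul_sub_mem hu hw ⟨ht0.le, ht1⟩
  have hexp : ∑ i, (u + t • (w - u)) i ^ 2 = ∑ i, u i ^ 2 + t * (2 * s + t * Q) := by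
    simp only [hs, hQ, mul_add, mul_sum, ← sum_add_distrib]
    refine sum_congr rfl fun i _ => ?_
    simp only [Pi.add_apply, Pi.smul_apply, Pi.sub_apply, smul_eq_mul]
    ring
  have h1 : 0 ≤ t * (2 * s + t * Q) := by
    have := isMinOn_iff.1 hmin _ hmem
    rw [hexp] at this
    linarith
  have h2 : 0 ≤ 2 * s + t * Q := nonneg_of_mul_nonneg_right h1 ht0
  have h3 : t * (Q - s) = -s := div_mul_cancel₀ _ hQs.ne'
  nlinarith

lemma IsPolymatroidRank.exists_isMajorized_basePolytope [DecidableEq E] {F : Finset E → ℝ}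
    (hF : IsPolymatroidRank F) : ∃ u, IsMajorized 1 (basePolytope F) u := by
  obtain ⟨x, hx, -⟩ := hF.exists_base_tight 0
  obtain ⟨u, hu, hmin⟩ := exists_first_order_min (isCompact_basePolytope F)
    (convex_basePolytope F) ⟨x, hx⟩
  refine ⟨u, hu, fun k hk1 hk w hw => ?_⟩
  obtain ⟨c, hc⟩ := exists_sumSmallest_le w hk1 hk
  -- Negating the weights turns upper level sets into the lower level set `{u ≤ c}`, with `c`
  -- supplied by the competitor `w`.
  have htight := hF.tight_of_max (fun i => -u i) u hu
    (fun y hy => by simpa [neg_mul, sum_neg_distrib] using hmin y hy) (-c)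
  simp only [neg_le_neg_iff] at htight
  have h1 : ∑ i, max (c - u i) 0 = ∑ i with u i ≤ c, (c - u i) := by
    rw [sum_filter]
    refine sum_congr rfl fun i _ => ?_
    split_ifs with h
    · exact max_eq_left (by linarith)
    · exact max_eq_right (by linarith)
  have h2 : ∑ i with u i ≤ c, (c - w i) ≤ ∑ i, max (c - w i) 0 :=
    (sum_le_sum fun i _ => le_max_left _ _).trans
      (sum_le_sum_of_subset_of_nonneg (subset_univ _) fun i _ _ => le_max_right _ _)
  have h3 := hw.1.2 {i | u i ≤ c}
  have h4 := sub_sum_max_le_sumSmallest u hk c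
  rw [h1, sum_sub_distrib, htight] at h4
  rw [sum_sub_distrib] at h2
  rw [div_one, one_mul]
  linarith

end Majorized

/-! ### Full-revelation policies -/

section Signals

variable {E : Type*} {vals : Finset ℝ}

lemma signalProb_fullRevelation (D : E → PMF vals) (i : E) (s : vals) :
    signalProb D (fullRevelation E vals) i s = (D i s).toReal := by
  rw [signalProb, sum_eq_single_of_mem s (mem_univ s)]
  · simp [PMF.pure_apply]
  · intro a _ ha
    simp [PMF.pure_apply, ha.symm]

lemma posteriorMean_fullRevelation (D : E → PMF vals) (i : E) (s : vals)
    (hs : (D i s).toReal ≠ 0) : posteriorMean D (fullRevelation E vals) i s = s := by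
  rw [posteriorMean, signalProb_fullRevelation, sum_eq_single_of_mem s (mem_univ s)]
  · simp only [PMF.pure_apply, if_true, ENNReal.toReal_one, mul_one]
    exact mul_div_cancel_left₀ _ hs
  · intro a _ ha
    simp [PMF.pure_apply, ha.symm]

lemma profileProb_fullRevelation [Fintype E] (D : E → PMF vals) (σ : E → vals) :
    profileProb D (fullRevelation E vals) σ = ∏ i, (D i (σ i)).toReal :=
  prod_congr rfl fun i _ => signalProb_fullRevelation D i (σ i)

lemma profileProb_fullRevelation_nonneg [Fintype E] (D : E → PMF vals) (σ : E → vals) :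
    0 ≤ profileProb D (fullRevelation E vals) σ := by
  rw [profileProb_fullRevelation]
  exact prod_nonneg fun i _ => ENNReal.toReal_nonneg

lemma posteriorMean_eq_of_profileProb_pos [Fintype E] (D : E → PMF vals) (σ : E → vals)
    (hσ : profileProb D (fullRevelation E vals) σ ≠ 0) (i : E) :
    posteriorMean D (fullRevelation E vals) i (σ i) = σ i := by
  rw [profileProb_fullRevelation] at hσ
  exact posteriorMean_fullRevelation D i _ (prod_ne_zero_iff.1 hσ i (mem_univ i))

end Signals

section FullRevelation

variable {E : Type*} [Fintype E] [DecidableEq E] {f : Finset E → ℝ} {vals : Finset ℝ}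

lemma expectedSaturation_eq (D : E → PMF vals) :
    expectedSaturation f D = fun S => ∑ a : E → vals,
      profileProb D (fullRevelation E vals) a * saturation f (fun i => (a i : ℝ)) S := by
  funext S
  simp only [profileProb_fullRevelation, expectedSaturation]

lemma isPolymatroidRank_expectedSaturation (hf : IsPolymatroidRank f)
    (hvals : ∀ v ∈ vals, 0 < v) (D : E → PMF vals) :
    IsPolymatroidRank (expectedSaturation f D) := by
  rw [expectedSaturation_eq]
  exact IsPolymatroidRank.sum_mul _ _ _ (fun a _ => profileProb_fullRevelation_nonneg D a)
    fun a _ => isPolymatroidRank_saturation hf fun i => hvals _ (a i).2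

/-- The expected utility of an agent under a fixed selection rule. -/
def ruleUtility (D : E → PMF vals) (x : (E → vals) → E → ℝ) (i : E) : ℝ :=
  ∑ σ : E → vals, profileProb D (fullRevelation E vals) σ *
    (posteriorMean D (fullRevelation E vals) i (σ i) * x σ i)

/-- Null profiles, where neither optimality nor the posterior mean is controlled, carry weight zero.
-/
lemma ruleUtility_mem_basePolytope (hf : IsPolymatroidRank f) (hvals : ∀ v ∈ vals, 0 < v)
    (D : E → PMF vals) {x : (E → vals) → E → ℝ}
    (hx : IsSelectionRule f D (fullRevelation E vals) x) :
    ruleUtility D x ∈ basePolytope (expectedSaturation f D) := by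
  have hpos : ∀ (σ : E → vals) i, 0 < (σ i : ℝ) := fun σ i => hvals _ (σ i).2
  have hterm : ∀ (σ : E → vals) i, profileProb D (fullRevelation E vals) σ *
      (posteriorMean D (fullRevelation E vals) i (σ i) * x σ i)
      = profileProb D (fullRevelation E vals) σ * ((σ i : ℝ) * x σ i) := fun σ i => by
    by_cases h : profileProb D (fullRevelation E vals) σ = 0
    · rw [h, zero_mul, zero_mul]
    · rw [posteriorMean_eq_of_profileProb_pos D σ h]
  have hbase : ∀ σ : E → vals, profileProb D (fullRevelation E vals) σ ≠ 0 →
      (fun i => (σ i : ℝ) * x σ i) ∈ basePolytope (saturation f fun i => (σ i : ℝ)) := by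
    intro σ h
    rw [saturation_eq_weightedLevelGain hf (hpos σ)]
    refine mul_mem_basePolytope_of_welfareOptimal hf (hpos σ) ?_
    have := (hx σ).2 (lt_of_le_of_ne (profileProb_fullRevelation_nonneg D σ) h.symm)
    simpa only [posteriorMean_eq_of_profileProb_pos D σ h] using this
  have hsum : ∀ S : Finset E, ∑ i ∈ S, ruleUtility D x i
      = ∑ σ : E → vals, profileProb D (fullRevelation E vals) σ *
        ∑ i ∈ S, (σ i : ℝ) * x σ i := fun S => by
    simp only [ruleUtility, hterm, mul_sum]
    exact sum_comm
  rw [expectedSaturation_eq]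
  refine ⟨⟨fun i => ?_, fun S => ?_⟩, ?_⟩
  · simp only [ruleUtility, hterm]
    exact sum_nonneg fun σ _ => mul_nonneg (profileProb_fullRevelation_nonneg D σ)
      (mul_nonneg (hpos σ i).le ((hx σ).1.1 i))
  · rw [hsum]
    refine sum_le_sum fun σ _ => ?_
    by_cases h : profileProb D (fullRevelation E vals) σ = 0
    · rw [h, zero_mul, zero_mul]
    · exact mul_le_mul_of_nonneg_left ((hbase σ h).1.2 S) (profileProb_fullRevelation_nonneg D σ)
  · rw [hsum]
    refine sum_congr rfl fun σ _ => ?_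
    by_cases h : profileProb D (fullRevelation E vals) σ = 0
    · rw [h, zero_mul, zero_mul]
    · rw [(hbase σ h).2]

lemma measurable_ruleUtility (D : E → PMF vals) (i : E) :
    Measurable fun x : (E → vals) → E → ℝ => ruleUtility D x i := by
  unfold ruleUtility
  fun_prop

lemma utility_eq (D : E → PMF vals) (Ω : Policy f D (fullRevelation E vals)) (i : E) :
    Ω.utility i = ∫ x, ruleUtility D x i ∂Ω.law := rfl

lemma utility_mem_basePolytope (hf : IsPolymatroidRank f) (hvals : ∀ v ∈ vals, 0 < v)
    (D : E → PMF vals) (Ω : Policy f D (fullRevelation E vals)) :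
    Ω.utility ∈ basePolytope (expectedSaturation f D) := by
  have : IsProbabilityMeasure Ω.law := Ω.isProbability
  have hae : ∀ᵐ x ∂Ω.law, ruleUtility D x ∈ basePolytope (expectedSaturation f D) :=
    Ω.isSelectionRule.mono fun x hx => ruleUtility_mem_basePolytope hf hvals D hx
  have hint : ∀ i, Integrable (fun x => ruleUtility D x i) Ω.law := fun i =>
    Integrable.of_bound (measurable_ruleUtility D i).aestronglyMeasurable
      (expectedSaturation f D {i}) (hae.mono fun x hx => by
        rw [Real.norm_of_nonneg (hx.1.1 i)]
        simpa using hx.1.2 {i})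
  have hsum : ∀ S : Finset E, ∑ i ∈ S, Ω.utility i
      = ∫ x, ∑ i ∈ S, ruleUtility D x i ∂Ω.law := fun S => by
    rw [integral_finsetSum _ fun i _ => hint i]
    rfl
  refine ⟨⟨fun i => ?_, fun S => ?_⟩, ?_⟩
  · rw [utility_eq]
    exact integral_nonneg_of_ae (hae.mono fun x hx => hx.1.1 i)
  · rw [hsum]
    calc _ ≤ ∫ _, expectedSaturation f D S ∂Ω.law :=
          integral_mono_ae (integrable_finsetSum _ fun i _ => hint i) (integrable_const _)
            (hae.mono fun x hx => hx.1.2 S)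
      _ = _ := by simp
  · rw [hsum, integral_congr_ae (hae.mono fun x hx => hx.2)]
    simp

/-- The policy that always uses the same selection rule. -/
def Policy.dirac (D : E → PMF vals) (x : (E → vals) → E → ℝ)
    (hx : IsSelectionRule f D (fullRevelation E vals) x) : Policy f D (fullRevelation E vals) where
  law := Measure.dirac x
  isProbability := Measure.dirac.isProbabilityMeasure
  isSelectionRule := by
    rw [ae_dirac_eq]
    exact hx

lemma utility_dirac (D : E → PMF vals) (x : (E → vals) → E → ℝ)
    (hx : IsSelectionRule f D (fullRevelation E vals) x) (i : E) :
    (Policy.dirac D x hx).utility i = ruleUtility D x i := by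
  rw [utility_eq]
  exact integral_dirac' _ _ (measurable_ruleUtility D i).stronglyMeasurable

/-- A deterministic rule suffices: the Minkowski decomposition prescribes a utility vector for each
profile, and dividing by the values recovers optimal allocations. -/
lemma mem_fullRevelationUtilities_of_mem_basePolytope (hf : IsPolymatroidRank f)
    (hvals : ∀ v ∈ vals, 0 < v) (D : E → PMF vals) {z : E → ℝ}
    (hz : z ∈ basePolytope (expectedSaturation f D)) : z ∈ fullRevelationUtilities f D := by
  have hpos : ∀ (σ : E → vals) i, 0 < (σ i : ℝ) := fun σ i => hvals _ (σ i).2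
  rw [expectedSaturation_eq] at hz
  obtain ⟨y, hy, rfl⟩ := exists_decomposition_of_mem_basePolytope _ _
    (fun σ => isPolymatroidRank_saturation hf (hpos σ)) hz
  have hopt : ∀ σ : E → vals,
      (fun i => y σ i / (σ i : ℝ)) ∈ welfareOptimal f fun i => (σ i : ℝ) :=
    fun σ => div_mem_welfareOptimal hf (hpos σ)
      (saturation_eq_weightedLevelGain hf (hpos σ) ▸ hy σ)
  have hrule : IsSelectionRule f D (fullRevelation E vals) fun σ i => y σ i / (σ i : ℝ) := by
    refine fun σ => ⟨(hopt σ).1, fun h => ?_⟩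
    simpa only [posteriorMean_eq_of_profileProb_pos D σ h.ne'] using hopt σ
  refine ⟨Policy.dirac D _ hrule, ?_⟩
  · funext i
    refine (utility_dirac D _ hrule i).trans ?_
    rw [ruleUtility, Finset.sum_apply]
    refine sum_congr rfl fun σ _ => ?_
    by_cases h : profileProb D (fullRevelation E vals) σ = 0
    · simp [h]
    · rw [posteriorMean_eq_of_profileProb_pos D σ h, mul_div_cancel₀ _ (hpos σ i).ne',
        Pi.smul_apply, smul_eq_mul]

lemma fullRevelationUtilities_eq (hf : IsPolymatroidRank f) (hvals : ∀ v ∈ vals, 0 < v)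
    (D : E → PMF vals) :
    fullRevelationUtilities f D = basePolytope (expectedSaturation f D) := by
  refine Set.Subset.antisymm ?_ fun z => mem_fullRevelationUtilities_of_mem_basePolytope hf hvals D
  rintro _ ⟨Ω, rfl⟩
  exact utility_mem_basePolytope hf hvals D Ω

end FullRevelation

end Persuasion

end

theorem mainTheorem3 {E : Type*} [Fintype E] [DecidableEq E]
    (f : Finset E → ℝ) (hf : Persuasion.IsPolymatroidRank f)
    (vals : Finset ℝ) (hvals : ∀ v ∈ vals, 0 < v) (D : E → PMF vals) :
    (∃ u, Persuasion.IsMajorized 1 (Persuasion.fullRevelationUtilities f D) u) ∧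
    Persuasion.IsPolymatroidRank (Persuasion.expectedSaturation f D) ∧
    Persuasion.fullRevelationUtilities f D =
      Persuasion.basePolytope (Persuasion.expectedSaturation f D) ∧
    (∀ (a : E → vals) (S : Finset E),
      IsGreatest (Persuasion.groupUtilities f (fun i => (a i : ℝ)) S)
        (Persuasion.saturation f (fun i => (a i : ℝ)) S)) := by
  have hF := Persuasion.isPolymatroidRank_expectedSaturation hf hvals D
  have hU := Persuasion.fullRevelationUtilities_eq hf hvals D
  refine ⟨hU ▸ hF.exists_isMajorized_basePolytope, hF, hU, fun a S => ?_⟩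
  have ha : ∀ i, 0 < (a i : ℝ) := fun i => hvals _ (a i).2
  rw [Persuasion.saturation_eq_weightedLevelGain hf ha]
  exact Persuasion.isGreatest_weightedLevelGain hf ha S
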